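/- Let $\mathbb H=L^2([0,1])$ be the real Hilbert space with its usual scalar product. One observes $n\ge 1$ independent copies $(X_i,Y_i)_{1\le i\le n}$ of a pair $(X,Y)$ of random elements of $\mathbb H$ with $$Y=SX+\varepsilon ,$$ where $X$ and $\varepsilon$ are independent, $X$ is centered with $\mathbb E\|X\|^2<\infty$, $\varepsilon$ is a centered Gaussian random element of $\mathbb H$, and the unknown $S$ is an integral operator $Sf(t)=\int_0^1\mathcal S(s,t)f(s)\,ds$ with kernel $\mathcal S\in L^2([0,1]^2)$. Let $\Gamma f=\mathbb E[\langle X,f\rangle X]$ and $\Gamma_\varepsilon f=\mathbb E[\langle \varepsilon,f\rangle\varepsilon]$ be the covariance operators. Let $(\varphi_j)_{j\ge1}$ be an orthonormal basis of $\mathbb H$ with $\Gamma\varphi_j=\lambda_j\varphi_j$, where $(\lambda_j)_{j\ge1}$ is non-increasing and $\lambda_j>0$ for all $j$. For sequences, $a_j\asymp b_j$ means that there is $c\ge1$ with $c^{-1}a_j\le b_j\le c\,a_j$ for all $j\ge1$. Let $\alpha,\beta,R>0$ and let $\eta_\alpha,\psi_\beta$ be sequences such that $\psi_\beta(j)\asymp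 j^\beta$ or $\psi_\beta(j)\asymp\exp(j^\beta)$. Let $\mathcal W_{\alpha,\beta}^R$ be the set of Hilbert–Schmidt operators $T$ on $\mathbb H$ with $$\sum_{j\ge1}\sum_{r\ge1}\eta_\alpha(j)\,\psi_\beta(r)\,\langle T\varphi_j,\varphi_r\rangle^2\le R^2 .$$ Assume that the noise is non-degenerate in the following sense: for some constants $\sigma_1>0$ and $K$ there is a unit vector $u\in\mathbb H$ with $$\sum_{r\ge1}\psi_\beta(r)\langle u,\varphi_r\rangle^2\le K\qquad\text{and}\qquad \langle\Gamma_\varepsilon f,f\rangle\ge\sigma_1\langle u,f\rangle^2\ \text{ for all } f\in\mathbb H .$$ (For $u=\varphi_1$ and $K=\psi_\beta(1)$ this says $\|\Gamma_\varepsilon^{-1/2}\varphi_1\|^2\le1/\sigma_1$.) An estimator $\widehat S_n$ is a bounded operator on $\mathbb H$ that is a measurable function of the sample (i.e. $\widehat S_n x$ is a measurable function of the sample for each $x\in\mathbb H$), and $\mathrm{MSPE}(\widehat S_n)=\mathbb E\|\widehat S_n X_{n+1}-SX_{n+1}\|^2\in[0,\infty]$, where $X_{n+1}$ is a copy of $X$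 independent of the sample. Below, infima are over all estimators, and suprema are over all integral operators $S$ with kernel in $L^2([0,1]^2)$ such that $S\Gamma^{1/2}\in\mathcal W_{\alpha,\beta}^R$. Then: 1. (polynomial case) If $\eta_\alpha(j)\asymp j^\alpha$, there is a constant $C>0$ such that, for all $n\ge1$, $$\inf_{\widehat S_n}\ \sup_{S\Gamma^{1/2}\in\mathcal W_{\alpha,\beta}^R}\mathrm{MSPE}(\widehat S_n)\ \ge\ C\,n^{-\frac{\alpha}{\alpha+1}} .$$ 2. (exponential case) If $\eta_\alpha(j)\asymp\exp(j^\alpha)$, there is a constant $C>0$ such that, for all $n\ge1$, $$\inf_{\widehat S_n}\ \sup_{S\Gamma^{1/2}\in\mathcal W_{\alpha,\beta}^R}\mathrm{MSPE}(\widehat S_n)\ \ge\ C\,\frac{(\ln n)^{1/\alpha}}{n} .$$ In both cases $C$ depends only on $\alpha,\beta,R,\eta_\alpha,\psi_\beta,\sigma_1$ and $K$; it depends neither on $n$ nor otherwise on the laws of $X$ and $\varepsilon$. -/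

import Mathlib

open MeasureTheory ProbabilityTheory
open scoped ENNReal InnerProductSpace

noncomputable section

namespace FunLinReg

/-- The real Hilbert space `L²([0,1])`. -/
abbrev L2 : Type := Lp ℝ 2 (volume : Measure unitInterval)

instance : MeasurableSpace L2 := borel L2

instance : BorelSpace L2 := ⟨rfl⟩

instance : SecondCountableTopology L2 :=
  haveI : Fact ((2 : ℝ≥0∞) ≠ ∞) := ⟨by simp⟩
  inferInstance

/-- `a_j ≍ b_j` for `j ≥ 1`: there is `c ≥ 1` with `c⁻¹ a_j ≤ b_j ≤ c a_j` for all `j ≥ 1`. -/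
def Asymp (a b : ℕ → ℝ) : Prop :=
  ∃ c : ℝ, 1 ≤ c ∧ ∀ j : ℕ, 1 ≤ j → c⁻¹ * a j ≤ b j ∧ b j ≤ c * a j

/-- The polynomial case, `a_j ≍ j ^ γ`. -/
def PolyCase (γ : ℝ) (a : ℕ → ℝ) : Prop :=
  Asymp a (fun j => (j : ℝ) ^ γ)

/-- The exponential case, `a_j ≍ exp (j ^ γ)`. -/
def ExpCase (γ : ℝ) (a : ℕ → ℝ) : Prop :=
  Asymp a (fun j => Real.exp ((j : ℝ) ^ γ))

/-- `S` is an integral operator with square integrable kernel `k`: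
`(S f)(t) = ∫₀¹ k(s,t) f(s) ds`. -/
def IsL2IntegralOperator (S : L2 →L[ℝ] L2) : Prop :=
  ∃ k : Lp ℝ 2 (volume : Measure (unitInterval × unitInterval)),
    ∀ f : L2, ∀ᵐ t : unitInterval, S f t = ∫ s : unitInterval, k (s, t) * f s

/-- Hilbert–Schmidt operators on `L²([0,1])`
(the condition does not depend on the orthonormal basis). -/
def IsHilbertSchmidt (T : L2 →L[ℝ] L2) : Prop :=
  ∃ b : HilbertBasis ℕ ℝ L2, Summable (fun j => ‖T (b j)‖ ^ 2)

open Classical in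
/-- The positive square root of a positive operator: the (unique) positive operator `G` with
`G ∘ G = T`. It exists for every positive `T`; other operators get the value `0`. -/
def posSqrt (T : L2 →L[ℝ] L2) : L2 →L[ℝ] L2 :=
  if h : ∃ G : L2 →L[ℝ] L2, G.IsPositive ∧ G ∘L G = T then h.choose else 0

/-- `P` is the law of a centered random variable with finite second moment whose covariance
operator has the orthonormal eigenbasis `φ` and the eigenvalues `lam`, listed in
non-increasing order and all positive. The `j`-th eigenpair of the usual numbering `j ≥ 1` has
index `j - 1` here. -/
structure IsCovariateLaw (P : Measure L2) (φ : HilbertBasis ℕ ℝ L2) (lam : ℕ → ℝ) : Prop where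
  isProbabilityMeasure : IsProbabilityMeasure P
  memLp : MemLp (id : L2 → L2) 2 P
  centered : ∫ x, x ∂P = 0
  eigen : ∀ j, covarianceOperator P (φ j) = lam j • φ j
  antitone : Antitone lam
  pos : ∀ j, 0 < lam j

/-- `Q` is the law of a centered Gaussian noise. -/
structure IsGaussianNoiseLaw (Q : Measure L2) : Prop where
  isGaussian : IsGaussian Q
  centered : ∫ e, e ∂Q = 0

/-- The noise law `Q` charges some direction `u` that is smooth on the scale given by `ψ`:
`u` is a unit vector with `∑_{r ≥ 1} ψ(r) ⟨u, φ_r⟩² ≤ K`, and `E⟨ε, f⟩² ≥ s ⟨u, f⟩²` for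
every `f`, that is, `Γ_ε - s u ⊗ u` is non-negative. -/
def NoiseCharges (Q : Measure L2) (φ : HilbertBasis ℕ ℝ L2) (ψ : ℕ → ℝ) (K s : ℝ) : Prop :=
  ∃ u : L2, ‖u‖ = 1 ∧
    (∑' r : ℕ, ENNReal.ofReal (ψ (r + 1) * ⟪u, φ r⟫_ℝ ^ 2)) ≤ ENNReal.ofReal K ∧
    ∀ f : L2, s * ⟪u, f⟫_ℝ ^ 2 ≤ ⟪covarianceOperator Q f, f⟫_ℝ

/-- The ellipsoid of Hilbert–Schmidt operators `T` with
`∑_{j ≥ 1} ∑_{r ≥ 1} η(j) ψ(r) ⟨T φ_j, φ_r⟩² ≤ R²`. -/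
def ellipsoid (η ψ : ℕ → ℝ) (R : ℝ) (φ : HilbertBasis ℕ ℝ L2) : Set (L2 →L[ℝ] L2) :=
  {T | IsHilbertSchmidt T ∧
    (∑' j : ℕ, ∑' r : ℕ, ENNReal.ofReal (η (j + 1) * ψ (r + 1) * ⟪T (φ j), φ r⟫_ℝ ^ 2))
      ≤ ENNReal.ofReal (R ^ 2)}

/-- The admissible slope operators: the integral operators `S` with square integrable kernel
such that `S Γ^{1/2}` lies in the ellipsoid, `Γ` being the covariance operator of `P`. -/
def slopeClass (P : Measure L2) (η ψ : ℕ → ℝ) (R : ℝ) (φ : HilbertBasis ℕ ℝ L2) :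
    Set (L2 →L[ℝ] L2) :=
  {S | IsL2IntegralOperator S ∧ S ∘L posSqrt (covarianceOperator P) ∈ ellipsoid η ψ R φ}

/-- The law of `(X, Y)` with `Y = S X + ε`, where `X` and `ε` are independent with laws `P`
and `Q`. -/
def pairLaw (P Q : Measure L2) (S : L2 →L[ℝ] L2) : Measure (L2 × L2) :=
  (P.prod Q).map (fun p => (p.1, S p.1 + p.2))

/-- The law of a sample `(X_1, Y_1), …, (X_n, Y_n)` of independent copies of `(X, Y)`. -/
def sampleLaw (P Q : Measure L2) (S : L2 →L[ℝ] L2) (n : ℕ) : Measure (Fin n → L2 × L2) :=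
  Measure.pi (fun _ => pairLaw P Q S)

/-- An estimator: a bounded operator that is a measurable function of the sample
(measurability being that of `d ↦ Ŝ_d x` for every `x`). -/
structure Estimator (n : ℕ) where
  toFun : (Fin n → L2 × L2) → (L2 →L[ℝ] L2)
  measurable_apply : ∀ x : L2, Measurable (fun d => toFun d x)

/-- The mean squared prediction error `E ‖Ŝ X_{n+1} - S X_{n+1}‖²`, with values in `[0, ∞]`,
where `X_{n+1}` has law `P` and is independent of the sample. -/
def mspe (P Q : Measure L2) {n : ℕ} (Shat : Estimator n) (S : L2 →L[ℝ] L2) : ℝ≥0∞ :=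
  ∫⁻ d, ∫⁻ x, ‖Shat.toFun d x - S x‖ₑ ^ 2 ∂P ∂(sampleLaw P Q S n)

/-- The minimax risk: the infimum over all estimators of the supremum of the mean squared
prediction error over the admissible slope operators. -/
def minimaxRisk (P Q : Measure L2) (η ψ : ℕ → ℝ) (R : ℝ) (φ : HilbertBasis ℕ ℝ L2) (n : ℕ) :
    ℝ≥0∞ :=
  ⨅ Shat : Estimator n, ⨆ S ∈ slopeClass P η ψ R φ, mspe P Q Shat S

end FunLinReg

end

/-! The bound is Assouad's hypercube argument over rank one slopes `x ↦ ⟪w, x⟫ • u`, where `u` is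
the smooth direction charged by the noise. All slopes share the output direction `u`, so the weights
`ψ` enter only through the factor `K`, and the problem becomes a scalar regression of noise variance
at least `s`. With `w = ∑ (c_j / √λ_j) φ_j`, the slope satisfies `S Γ^{1/2} φ_j = c_j u`: the
prediction error and the statistical distance of two hypotheses are governed by the Euclidean
distance of the coefficients `c`, and the eigenvalues cancel.

The reduction to scalar noise is `exists_gaussian_decomposition`: `ε = z + t u` in law, with `t`
Gaussian of variance `v ≥ s` independent of `z`. The data are then a function of the finer
observations `(X, z, ⟪w, X⟫ + t)`, whose laws have explicit densities for one common reference
measure (`sampleLaw_rankOneOp`). The Hellinger affinity of two hypotheses is at least `1 - ‖c - c'‖²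
/ (8 v)`, and it tensorises over the sample (`two_point_pi`).

With `m` coefficients in `{0, √A}` and `A = κ / n`, no single coordinate can be decided, and the
risk is at least of order `m A`, that is `m / n` (`ofReal_le_minimaxRisk`). Membership in the
ellipsoid asks for `∑_{j ≤ m} η(j)` to be at most of order `n`; the largest such `m`, up to
constants, gives the two rates. -/

namespace FunLinReg

/-! ### Splitting an independent scalar Gaussian off the noise. -/

section GaussianDecomposition

open Filter Topology

/-- Constrained least-norm problem: minimise `‖T f‖` over the affine hyperplane `⟪u, f⟫ = 1`. -/
theorem exists_minimizer_of_le_norm_sq {H G : Type*} [NormedAddCommGroup H]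
    [InnerProductSpace ℝ H] [NormedAddCommGroup G] [InnerProductSpace ℝ G] [CompleteSpace G]
    (T : H →ₗ[ℝ] G) {u : H} (hu : ‖u‖ = 1) {s : ℝ}
    (hT : ∀ f, s * ⟪u, f⟫_ℝ ^ 2 ≤ ‖T f‖ ^ 2) :
    ∃ (g : G) (h : ℕ → H), Tendsto (fun k => T (h k)) atTop (𝓝 g) ∧ s ≤ ‖g‖ ^ 2 ∧
      ∀ f, ⟪g, T f⟫_ℝ = ‖g‖ ^ 2 * ⟪u, f⟫_ℝ := by
  set A : Set G := T '' {f | ⟪u, f⟫_ℝ = 1} with hA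
  have huu : ⟪u, u⟫_ℝ = 1 := by rw [real_inner_self_eq_norm_sq, hu]; norm_num
  have hAconv : Convex ℝ A := by
    refine Convex.linear_image ?_ T
    intro x hx y hy a b _ _ hab
    simp only [Set.mem_ofPred_eq] at hx hy ⊢
    rw [inner_add_right, inner_smul_right, inner_smul_right, hx, hy]
    linarith
  have hne : (closure A).Nonempty := ⟨T u, subset_closure ⟨u, huu, rfl⟩⟩
  -- The infimum need not be attained in `H`, so the origin is projected onto the closure in `G`;
  -- `g` is only a limit of values of `T`.
  obtain ⟨g, hg, hmin⟩ := exists_norm_eq_iInf_of_complete_convex hne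
    isClosed_closure.isComplete hAconv.closure 0
  have hle := (norm_eq_iInf_iff_real_inner_le_zero hAconv.closure hg).1 hmin
  have hle' : ∀ w ∈ closure A, ‖g‖ ^ 2 ≤ ⟪g, w⟫_ℝ := by
    intro w hw
    have := hle w hw
    rw [zero_sub, inner_neg_left, inner_sub_right, real_inner_self_eq_norm_sq] at this
    linarith
  obtain ⟨x, hx, hlim⟩ := mem_closure_iff_seq_limit.1 hg
  choose h hh hTh using hx
  have hlim' : Tendsto (fun k => T (h k)) atTop (𝓝 g) := by simpa only [hTh] using hlim
  -- First variation: `closure A` is stable under adding `c • T f` for `f ⊥ u`, and both signs of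
  -- `c` are allowed.
  have horth : ∀ f, ⟪u, f⟫_ℝ = 0 → ⟪g, T f⟫_ℝ = 0 := by
    intro f hf
    have key : ∀ c : ℝ, 0 ≤ c * ⟪g, T f⟫_ℝ := by
      intro c
      have hmem : g + c • T f ∈ closure A := by
        refine mem_closure_of_tendsto (hlim'.add_const _) (Eventually.of_forall fun k => ?_)
        refine ⟨h k + c • f, ?_, by simp⟩
        have := hh k
        simp only [Set.mem_ofPred_eq] at this ⊢
        rw [inner_add_right, inner_smul_right, this, hf]; simp
      have := hle' _ hmem
      rw [inner_add_right, inner_smul_right, real_inner_self_eq_norm_sq] at this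
      linarith
    have h1 := key 1
    have h2 := key (-1)
    linarith
  have hgu : ⟪g, T u⟫_ℝ = ‖g‖ ^ 2 := by
    have hk : ∀ k, ⟪g, T (h k)⟫_ℝ = ⟪g, T u⟫_ℝ := by
      intro k
      have := horth (h k - u) (by
        have := hh k
        simp only [Set.mem_ofPred_eq] at this
        rw [inner_sub_right, this, huu, sub_self])
      rw [map_sub, inner_sub_right] at this
      linarith
    have h1 : Tendsto (fun k => ⟪g, T (h k)⟫_ℝ) atTop (𝓝 ⟪g, g⟫_ℝ) :=
      tendsto_const_nhds.inner hlim'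
    simp only [hk] at h1
    rw [tendsto_nhds_unique tendsto_const_nhds h1, real_inner_self_eq_norm_sq]
  refine ⟨g, h, hlim', ?_, fun f => ?_⟩
  · refine ge_of_tendsto (hlim'.norm.pow 2) (Eventually.of_forall fun k => ?_)
    have h1 := hT (h k)
    have h2 : ⟪u, h k⟫_ℝ = 1 := hh k
    rw [h2] at h1
    linarith
  · have := horth (f - ⟪u, f⟫_ℝ • u) (by
      rw [inner_sub_right, inner_smul_right, huu]; ring)
    rw [map_sub, map_smul, inner_sub_right, inner_smul_right, hgu] at this
    linarith

variable {H : Type*} [NormedAddCommGroup H] [InnerProductSpace ℝ H] [MeasurableSpace H]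

/-- The linear functional `⟪f, ·⟫` as an element of `L²(Q)`. -/
noncomputable def innerLp (Q : Measure H) (hQ : MemLp (id : H → H) 2 Q) : H →ₗ[ℝ] Lp ℝ 2 Q where
  toFun f := (hQ.const_inner f).toLp
  map_add' f g := by
    rw [← MemLp.toLp_add]
    congr 1
    ext z
    simp [inner_add_left]
  map_smul' c f := by
    simp only [RingHom.id_apply]
    rw [← MemLp.toLp_const_smul]
    congr 1
    ext z
    simp [inner_smul_left]

theorem coeFn_innerLp {Q : Measure H} (hQ : MemLp (id : H → H) 2 Q) (f : H) :
    innerLp Q hQ f =ᵐ[Q] fun z => ⟪f, z⟫_ℝ := (hQ.const_inner f).coeFn_toLp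

variable [CompleteSpace H] [BorelSpace H]

theorem inner_innerLp {Q : Measure H} (hQ : MemLp (id : H → H) 2 Q) (f g : H) :
    ⟪innerLp Q hQ f, innerLp Q hQ g⟫_ℝ = ⟪covarianceOperator Q f, g⟫_ℝ := by
  rw [covarianceOperator_inner hQ, L2.inner_def]
  refine integral_congr_ae ?_
  filter_upwards [coeFn_innerLp hQ f, coeFn_innerLp hQ g] with z h1 h2
  rw [h1, h2]
  simp [mul_comm]

theorem norm_sq_innerLp {Q : Measure H} (hQ : MemLp (id : H → H) 2 Q) (f : H) :
    ‖innerLp Q hQ f‖ ^ 2 = ⟪covarianceOperator Q f, f⟫_ℝ := by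
  rw [← real_inner_self_eq_norm_sq, inner_innerLp]

variable [SecondCountableTopology H]

/-- Writing the exponent as an `L²(Q)` norm lets limits of linear functionals in `L²(Q)` pass to
characteristic functions. -/
theorem charFun_centered_gaussian (Q : Measure H) [IsGaussian Q] (h0 : ∫ e, e ∂Q = 0) (f : H) :
    charFun Q f = Complex.exp (-(‖innerLp Q IsGaussian.memLp_two_id f‖ ^ 2 : ℝ) / 2) := by
  have h0' : Q[id] = 0 := h0
  rw [IsGaussian.charFun_eq', h0', norm_sq_innerLp, covarianceOperator_inner
    IsGaussian.memLp_two_id, covarianceBilin_apply IsGaussian.memLp_two_id, h0']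
  simp [neg_div]

/-- A centered Gaussian measure whose covariance dominates `s • u ⊗ u` is the law of `z + t • u`,
where `t` is a real Gaussian variable of variance at least `s`, independent of `z`. -/
theorem exists_gaussian_decomposition (Q : Measure H) [IsGaussian Q] (h0 : ∫ e, e ∂Q = 0)
    {u : H} (hu : ‖u‖ = 1) {s : ℝ}
    (hs : ∀ f : H, s * ⟪u, f⟫_ℝ ^ 2 ≤ ⟪covarianceOperator Q f, f⟫_ℝ) :
    ∃ (ν : Measure H) (v : NNReal), IsProbabilityMeasure ν ∧ s ≤ v ∧
      Q = (ν.prod (gaussianReal 0 v)).map (fun p => p.1 + p.2 • u) := by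
  have hQ : MemLp (id : H → H) 2 Q := IsGaussian.memLp_two_id
  obtain ⟨g, h, hlim, hsg, hg⟩ := exists_minimizer_of_le_norm_sq (innerLp Q hQ) hu
    (fun f => by rw [norm_sq_innerLp]; exact hs f)
  have hgm : Measurable g := (Lp.stronglyMeasurable g).measurable
  obtain ⟨k, hk, hae⟩ := (tendstoInMeasure_of_tendsto_Lp hlim).exists_seq_tendsto_ae
  have hae' : ∀ᵐ z ∂Q, Tendsto (fun i => ⟪h (k i), z⟫_ℝ) atTop (𝓝 (g z)) := by
    have hall : ∀ᵐ z ∂Q, ∀ i, innerLp Q hQ (h (k i)) z = ⟪h (k i), z⟫_ℝ :=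
      ae_all_iff.2 fun i => coeFn_innerLp hQ _
    filter_upwards [hae, hall] with z h1 h2
    simpa only [h2] using h1
  have hmeas : Measurable fun z : H => z - g z • u := by fun_prop
  -- The relation for `g` says that `z - g z • u` is uncorrelated with `g`, which suggests the
  -- splitting. Independence is obtained without joint Gaussianity: `g` is an a.e. limit of `⟪h (k
  -- i), ·⟫`, so this characteristic function is a limit of those of `Q`.
  have hchar : ∀ f : H, charFun (Q.map fun z => z - g z • u) f =
      Complex.exp (-(‖innerLp Q hQ f‖ ^ 2 - ⟪u, f⟫_ℝ ^ 2 * ‖g‖ ^ 2 : ℝ) / 2) := by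
    intro f
    have h1 : Tendsto (fun i => charFun Q (f - ⟪u, f⟫_ℝ • h (k i))) atTop
        (𝓝 (charFun (Q.map fun z => z - g z • u) f)) := by
      simp only [charFun_apply]
      rw [integral_map hmeas.aemeasurable (by fun_prop)]
      refine tendsto_integral_of_dominated_convergence (fun _ => 1)
        (fun i => by fun_prop) (integrable_const _) (fun i => ?_) ?_
      · refine Eventually.of_forall fun z => ?_
        rw [Complex.norm_exp_ofReal_mul_I]
      · filter_upwards [hae'] with z hz
        have hz' : Tendsto (fun i => ⟪z, f - ⟪u, f⟫_ℝ • h (k i)⟫_ℝ) atTop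
            (𝓝 ⟪z - g z • u, f⟫_ℝ) := by
          have : ⟪z - g z • u, f⟫_ℝ = ⟪z, f⟫_ℝ - ⟪u, f⟫_ℝ * g z := by
            rw [inner_sub_left, inner_smul_left]; simp [mul_comm]
          rw [this]
          have hsplit : ∀ i, ⟪z, f - ⟪u, f⟫_ℝ • h (k i)⟫_ℝ =
              ⟪z, f⟫_ℝ - ⟪u, f⟫_ℝ * ⟪h (k i), z⟫_ℝ := fun i => by
            rw [inner_sub_right, inner_smul_right, real_inner_comm (h (k i)) z]
          simp only [hsplit]
          exact tendsto_const_nhds.sub (hz.const_mul _)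
        exact (Complex.continuous_exp.tendsto _).comp
          (((Complex.continuous_ofReal.tendsto _).comp hz').mul_const _)
    have h2 : Tendsto (fun i => charFun Q (f - ⟪u, f⟫_ℝ • h (k i))) atTop
        (𝓝 (Complex.exp (-(‖innerLp Q hQ f - ⟪u, f⟫_ℝ • g‖ ^ 2 : ℝ) / 2))) := by
      simp only [charFun_centered_gaussian Q h0, map_sub, map_smul]
      have hn : Tendsto (fun i => ‖innerLp Q hQ f - ⟪u, f⟫_ℝ • innerLp Q hQ (h (k i))‖ ^ 2) atTop
          (𝓝 (‖innerLp Q hQ f - ⟪u, f⟫_ℝ • g‖ ^ 2)) :=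
        ((tendsto_const_nhds.sub ((hlim.comp hk.tendsto_atTop).const_smul _)).norm).pow 2
      exact (Complex.continuous_exp.tendsto _).comp
        ((((Complex.continuous_ofReal.tendsto _).comp hn).neg).div_const _)
    rw [tendsto_nhds_unique h1 h2]
    congr 5
    rw [norm_sub_sq_real, inner_smul_right, real_inner_comm g, hg, norm_smul, mul_pow,
      Real.norm_eq_abs, sq_abs]
    ring
  have : IsProbabilityMeasure (Q.map fun z => z - g z • u) :=
    Measure.isProbabilityMeasure_map hmeas.aemeasurable
  refine ⟨Q.map fun z => z - g z • u, ‖g‖₊ ^ 2, this, by simpa using hsg, ?_⟩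
  set v : NNReal := ‖g‖₊ ^ 2 with hv
  have hsm : Measurable fun t : ℝ => t • u := by fun_prop
  have : IsProbabilityMeasure ((gaussianReal 0 v).map fun t : ℝ => t • u) :=
    Measure.isProbabilityMeasure_map hsm.aemeasurable
  have hconv : ((Q.map fun z => z - g z • u).prod (gaussianReal 0 v)).map
      (fun p => p.1 + p.2 • u) =
      (Q.map fun z => z - g z • u).conv ((gaussianReal 0 v).map fun t : ℝ => t • u) := by
    have hprod := Measure.map_prod_map (Q.map fun z => z - g z • u) (gaussianReal 0 v)
      measurable_id hsm
    rw [Measure.map_id] at hprod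
    rw [Measure.conv, hprod, Measure.map_map (by fun_prop) (by fun_prop)]
    rfl
  rw [hconv]
  -- The term `⟪u, f⟫² ‖g‖²` missing from the exponent of the first factor is exactly the variance
  -- contributed by `t • u`.
  refine Measure.ext_of_charFun ?_
  ext f
  have hgauss : charFun ((gaussianReal 0 v).map fun t : ℝ => t • u) f =
      charFun (gaussianReal 0 v) ⟪u, f⟫_ℝ := by
    rw [charFun_apply, charFun_apply, integral_map hsm.aemeasurable (by fun_prop)]
    simp [inner_smul_left, mul_comm]
  rw [charFun_conv, hchar, hgauss, charFun_gaussianReal, charFun_centered_gaussian Q h0,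
    ← Complex.exp_add]
  congr 1
  rw [hv, NNReal.coe_pow, coe_nnnorm]
  push_cast
  ring

end GaussianDecomposition

/-! ### Product densities, Hellinger affinity and the two-point inequality. -/

section ProductDensities

variable {α : Type*} [MeasurableSpace α]

theorem lintegral_pi_fin_prod (κ : Measure α) [SigmaFinite κ] :
    ∀ (n : ℕ) (f : Fin n → α → ℝ≥0∞), (∀ i, Measurable (f i)) →
      ∫⁻ x, ∏ i, f i (x i) ∂(Measure.pi fun _ : Fin n => κ) = ∏ i, ∫⁻ x, f i x ∂κ := by
  intro n
  induction n with
  | zero => intro f _; simp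
  | succ n ih =>
    intro f hf
    have hmp := (measurePreserving_piFinSuccAbove (fun _ : Fin (n + 1) => κ) 0).symm
    rw [← hmp.lintegral_comp_emb (MeasurableEquiv.measurableEmbedding _), Fin.prod_univ_succ,
      ← ih (fun i => f i.succ) fun i => hf _,
      ← lintegral_prod_mul (hf 0).aemeasurable
        (Finset.measurable_prod _ fun i _ => (hf i.succ).comp (measurable_pi_apply i)).aemeasurable]
    refine lintegral_congr fun x => ?_
    rw [Fin.prod_univ_succ]
    simp [MeasurableEquiv.piFinSuccAbove]

theorem pi_withDensity (κ : Measure α) [SigmaFinite κ] {p : α → ℝ≥0∞} (hp : Measurable p)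
    [SigmaFinite (κ.withDensity p)] (n : ℕ) :
    (Measure.pi fun _ : Fin n => κ.withDensity p) =
      (Measure.pi fun _ : Fin n => κ).withDensity fun x => ∏ i, p (x i) := by
  refine Measure.pi_eq fun s hs => ?_
  rw [withDensity_apply _ (.univ_pi hs), ← lintegral_indicator (.univ_pi hs)]
  have hind : ∀ x : Fin n → α, (Set.univ.pi s).indicator (fun x => ∏ i, p (x i)) x =
      ∏ i, (s i).indicator p (x i) := by
    intro x
    by_cases hx : x ∈ Set.univ.pi s
    · rw [Set.indicator_of_mem hx]
      exact Finset.prod_congr rfl fun i _ => (Set.indicator_of_mem (hx i trivial) p).symm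
    · rw [Set.indicator_of_notMem hx]
      obtain ⟨i, hi⟩ : ∃ i, x i ∉ s i := by simpa [Set.mem_pi] using hx
      exact (Finset.prod_eq_zero (Finset.mem_univ i) (Set.indicator_of_notMem hi p)).symm
  simp_rw [hind]
  rw [lintegral_pi_fin_prod κ n _ fun i => hp.indicator (hs i)]
  exact Finset.prod_congr rfl fun i _ => by
    rw [withDensity_apply _ (hs i), lintegral_indicator (hs i)]

/-- The square of the Hellinger affinity is controlled by the mass of the minimum. -/
theorem affinity_sq_le (κ : Measure α) {p q : α → ℝ≥0∞} (hp : Measurable p) (hq : Measurable q) :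
    (∫⁻ x, (p x * q x) ^ (1 / 2 : ℝ) ∂κ) ^ 2 ≤
      (∫⁻ x, min (p x) (q x) ∂κ) * (∫⁻ x, p x ∂κ + ∫⁻ x, q x ∂κ) := by
  have hroot : ∀ y : ℝ≥0∞, (y ^ (1 / 2 : ℝ)) ^ (2 : ℝ) = y := fun y => by
    rw [← ENNReal.rpow_mul]; norm_num
  -- Since `p q = min · max`, the affinity is an inner product of `√min` and `√max`; Cauchy–Schwarz
  -- and `max ≤ p + q` then conclude.
  have hsplit : ∀ x, (p x * q x) ^ (1 / 2 : ℝ) =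
      ((fun x => min (p x) (q x) ^ (1 / 2 : ℝ)) * fun x => max (p x) (q x) ^ (1 / 2 : ℝ)) x :=
    fun x => by
      rw [Pi.mul_apply, ← ENNReal.mul_rpow_of_nonneg _ _ (by norm_num), min_mul_max]
  simp_rw [hsplit]
  have hH := ENNReal.lintegral_mul_le_Lp_mul_Lq κ Real.HolderConjugate.two_two
    (f := fun x => min (p x) (q x) ^ (1 / 2 : ℝ)) (g := fun x => max (p x) (q x) ^ (1 / 2 : ℝ))
    ((hp.min hq).pow_const _).aemeasurable ((hp.max hq).pow_const _).aemeasurable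
  simp only [hroot] at hH
  calc _ ≤ ((∫⁻ x, min (p x) (q x) ∂κ) ^ (1 / 2 : ℝ) *
        (∫⁻ x, max (p x) (q x) ∂κ) ^ (1 / 2 : ℝ)) ^ 2 := pow_le_pow_left' hH 2
    _ = (∫⁻ x, min (p x) (q x) ∂κ) * ∫⁻ x, max (p x) (q x) ∂κ := by
        rw [mul_pow, ← ENNReal.rpow_natCast, ← ENNReal.rpow_natCast]
        push_cast
        rw [hroot, hroot]
    _ ≤ _ := by
        gcongr
        rw [← lintegral_add_left hp]
        exact lintegral_mono fun x => max_le le_self_add le_add_self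

/-- Le Cam's two-point inequality for product measures, in terms of the Hellinger affinity. -/
theorem two_point_pi (κ : Measure α) [SigmaFinite κ] {p q : α → ℝ≥0∞} (hp : Measurable p)
    (hq : Measurable q) [IsProbabilityMeasure (κ.withDensity p)]
    [IsProbabilityMeasure (κ.withDensity q)] (n : ℕ) {a : ℝ≥0∞} {f g : (Fin n → α) → ℝ≥0∞}
    (hf : Measurable f) (hg : Measurable g) (hfg : ∀ x, a ≤ f x + g x) :
    a * ((∫⁻ x, (p x * q x) ^ (1 / 2 : ℝ) ∂κ) ^ n) ^ 2 ≤
      2 * (∫⁻ x, f x ∂(Measure.pi fun _ : Fin n => κ.withDensity p) +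
        ∫⁻ x, g x ∂(Measure.pi fun _ : Fin n => κ.withDensity q)) := by
  have hpn : Measurable fun x : Fin n → α => ∏ i, p (x i) :=
    Finset.measurable_prod _ fun i _ => hp.comp (measurable_pi_apply i)
  have hqn : Measurable fun x : Fin n → α => ∏ i, q (x i) :=
    Finset.measurable_prod _ fun i _ => hq.comp (measurable_pi_apply i)
  have hone : ∀ r : α → ℝ≥0∞, Measurable r → IsProbabilityMeasure (κ.withDensity r) →
      ∫⁻ x : Fin n → α, ∏ i, r (x i) ∂(Measure.pi fun _ : Fin n => κ) = 1 := by
    intro r hr hpr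
    rw [lintegral_pi_fin_prod κ n (fun _ => r) fun _ => hr]
    have := hpr.measure_univ
    rw [withDensity_apply _ .univ, Measure.restrict_univ] at this
    simp [this]
  have haff : (∫⁻ x, (p x * q x) ^ (1 / 2 : ℝ) ∂κ) ^ n =
      ∫⁻ x : Fin n → α, ((∏ i, p (x i)) * ∏ i, q (x i)) ^ (1 / 2 : ℝ)
        ∂(Measure.pi fun _ : Fin n => κ) := by
    have := lintegral_pi_fin_prod κ n (fun _ x => (p x * q x) ^ (1 / 2 : ℝ))
      fun _ => (hp.mul hq).pow_const _
    simp only [Finset.prod_const, Finset.card_univ, Fintype.card_fin] at this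
    rw [← this]
    refine lintegral_congr fun x => ?_
    rw [← Finset.prod_mul_distrib, ENNReal.prod_rpow_of_nonneg (by norm_num)]
  have hsq := affinity_sq_le (Measure.pi fun _ : Fin n => κ) hpn hqn
  rw [hone p hp inferInstance, hone q hq inferInstance, one_add_one_eq_two] at hsq
  rw [haff, pi_withDensity κ hp, pi_withDensity κ hq,
    lintegral_withDensity_eq_lintegral_mul _ hpn hf,
    lintegral_withDensity_eq_lintegral_mul _ hqn hg, ← lintegral_add_left (hpn.mul hf)]
  calc _ ≤ a * ((∫⁻ x : Fin n → α, min (∏ i, p (x i)) (∏ i, q (x i))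
        ∂(Measure.pi fun _ : Fin n => κ)) * 2) := by gcongr
    _ = 2 * ∫⁻ x : Fin n → α, a * min (∏ i, p (x i)) (∏ i, q (x i))
        ∂(Measure.pi fun _ : Fin n => κ) := by
        rw [lintegral_const_mul _ (hpn.min hqn)]; ring
    _ ≤ _ := by
        gcongr with x
        simp only [Pi.mul_apply]
        calc _ ≤ (f x + g x) * min (∏ i, p (x i)) (∏ i, q (x i)) := by gcongr; exact hfg x
          _ = min (∏ i, p (x i)) (∏ i, q (x i)) * f x +
              min (∏ i, p (x i)) (∏ i, q (x i)) * g x := by ring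
          _ ≤ _ := by
            gcongr
            · exact min_le_left _ _
            · exact min_le_right _ _

end ProductDensities

/-! ### Affinity of two Gaussians of equal variance. -/

section GaussianAffinity

/-- Completing the square: the geometric mean of the two densities is a constant times the density
centered at the midpoint of the means. -/
theorem lintegral_sqrt_gaussianPDF_mul (m₁ m₂ : ℝ) {v : NNReal} (hv : v ≠ 0) :
    ∫⁻ t, (gaussianPDF m₁ v t * gaussianPDF m₂ v t) ^ (1 / 2 : ℝ) =
      ENNReal.ofReal (Real.exp (-((m₁ - m₂) ^ 2 / (8 * v)))) := by
  have hv' : (v : ℝ) ≠ 0 := by exact_mod_cast hv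
  have hpt : ∀ t, (gaussianPDF m₁ v t * gaussianPDF m₂ v t) ^ (1 / 2 : ℝ) =
      ENNReal.ofReal (Real.exp (-((m₁ - m₂) ^ 2 / (8 * v)))) *
        gaussianPDF ((m₁ + m₂) / 2) v t := by
    intro t
    have hsq : gaussianPDFReal m₁ v t * gaussianPDFReal m₂ v t =
        (Real.exp (-((m₁ - m₂) ^ 2 / (8 * v))) * gaussianPDFReal ((m₁ + m₂) / 2) v t) ^ 2 := by
      simp only [gaussianPDFReal]
      have hexp : Real.exp (-(t - m₁) ^ 2 / (2 * v)) * Real.exp (-(t - m₂) ^ 2 / (2 * v)) =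
          (Real.exp (-((m₁ - m₂) ^ 2 / (8 * v))) *
            Real.exp (-(t - (m₁ + m₂) / 2) ^ 2 / (2 * v))) ^ 2 := by
        rw [← Real.exp_add, ← Real.exp_add, ← Real.exp_nat_mul]
        congr 1
        push_cast
        field_simp
        ring
      linear_combination ((√(2 * Real.pi * v))⁻¹) ^ 2 * hexp
    have hnn : 0 ≤ Real.exp (-((m₁ - m₂) ^ 2 / (8 * v))) *
        gaussianPDFReal ((m₁ + m₂) / 2) v t :=
      mul_nonneg (Real.exp_pos _).le (gaussianPDFReal_nonneg _ _ _)
    rw [gaussianPDF, gaussianPDF, gaussianPDF, ← ENNReal.ofReal_mul (gaussianPDFReal_nonneg _ _ _),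
      hsq, ← ENNReal.ofReal_mul (Real.exp_pos _).le,
      ENNReal.ofReal_rpow_of_nonneg (by positivity) (by norm_num), ← Real.sqrt_eq_rpow,
      Real.sqrt_sq hnn]
  simp_rw [hpt]
  rw [lintegral_const_mul _ (measurable_gaussianPDF _ _), lintegral_gaussianPDF_eq_one _ hv,
    mul_one]

end GaussianAffinity

/-! ### The regression model with rank one slopes. -/

section RankOneModel

/-- The rank one operator `x ↦ ⟪w, x⟫ • u`. -/
noncomputable def rankOneOp (w u : L2) : L2 →L[ℝ] L2 := (innerSL ℝ w).smulRight u

theorem rankOneOp_apply (w u x : L2) : rankOneOp w u x = ⟪w, x⟫_ℝ • u := rfl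

/-- The density of `(X, Z, ⟪w, X⟫ + T)` with respect to `P ⊗ ν ⊗ Lebesgue`, where `T` is a
centered Gaussian variable of variance `v`. -/
noncomputable def shiftDensity (w : L2) (v : NNReal) (ω : L2 × L2 × ℝ) : ℝ≥0∞ :=
  gaussianPDF ⟪w, ω.1⟫_ℝ v ω.2.2

theorem measurable_shiftDensity (w : L2) (v : NNReal) : Measurable (shiftDensity w v) := by
  unfold shiftDensity gaussianPDF gaussianPDFReal
  fun_prop

/-- The map `(x, z, t) ↦ (x, z + t • u)`. -/
noncomputable def observe (u : L2) (ω : L2 × L2 × ℝ) : L2 × L2 := (ω.1, ω.2.1 + ω.2.2 • u)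

theorem measurable_observe (u : L2) : Measurable (observe u) := by
  unfold observe
  fun_prop

variable {P Q ν : Measure L2} [IsProbabilityMeasure ν] {v : NNReal}

theorem lintegral_shiftDensity_mul (hv : v ≠ 0) (w : L2) {f : L2 × L2 × ℝ → ℝ≥0∞}
    (hf : Measurable f) :
    ∫⁻ ω, f ω ∂((P.prod (ν.prod volume)).withDensity (shiftDensity w v)) =
      ∫⁻ x, ∫⁻ z, ∫⁻ t, f (x, z, t) ∂(gaussianReal ⟪w, x⟫_ℝ v) ∂ν ∂P := by
  have hd := measurable_shiftDensity w v
  rw [lintegral_withDensity_eq_lintegral_mul _ hd hf, lintegral_prod _ (hd.mul hf).aemeasurable]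
  refine lintegral_congr fun x => ?_
  have hx : Measurable fun y => (shiftDensity w v * f) (x, y) :=
    (hd.mul hf).comp measurable_prodMk_left
  rw [lintegral_prod _ hx.aemeasurable]
  refine lintegral_congr fun z => ?_
  rw [gaussianReal_of_var_ne_zero _ hv, lintegral_withDensity_eq_lintegral_mul _
    (measurable_gaussianPDF _ _) (by fun_prop)]
  rfl

theorem isProbabilityMeasure_shiftDensity [IsProbabilityMeasure P] (hv : v ≠ 0) (w : L2) :
    IsProbabilityMeasure ((P.prod (ν.prod volume)).withDensity (shiftDensity w v)) := by
  constructor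
  have := lintegral_shiftDensity_mul (P := P) (ν := ν) hv w (f := fun _ => 1) measurable_const
  simpa using this

/-- The signal `⟪w, X⟫ • u` is parallel to the split-off noise `t • u`, so it only shifts the mean
of `t`. The map `observe u` does not depend on `w`; hence all hypotheses are images of mutually
absolutely continuous laws under the same map. -/
theorem pairLaw_rankOneOp (hv : v ≠ 0) {u : L2}
    (hQ : Q = (ν.prod (gaussianReal 0 v)).map (fun p => p.1 + p.2 • u)) (w : L2) :
    pairLaw P Q (rankOneOp w u) =
      ((P.prod (ν.prod volume)).withDensity (shiftDensity w v)).map (observe u) := by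
  have hm : Measurable fun p : L2 × ℝ => p.1 + p.2 • u := by fun_prop
  have hQp : IsProbabilityMeasure Q := by
    rw [hQ]; exact Measure.isProbabilityMeasure_map hm.aemeasurable
  refine Measure.ext_of_lintegral _ fun f hf => ?_
  have hS : Measurable fun p : L2 × L2 => (p.1, rankOneOp w u p.1 + p.2) := by fun_prop
  have hfS : Measurable fun p : L2 × L2 => f (p.1, rankOneOp w u p.1 + p.2) := hf.comp hS
  have hfo : Measurable fun ω => f (observe u ω) := hf.comp (measurable_observe u)
  rw [pairLaw, lintegral_map hf hS, lintegral_map hf (measurable_observe u),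
    lintegral_shiftDensity_mul hv w hfo, lintegral_prod _ hfS.aemeasurable]
  refine lintegral_congr fun x => ?_
  have hfx : Measurable fun y => f (x, rankOneOp w u x + y) := by fun_prop
  have hfm : Measurable fun p : L2 × ℝ => f (x, rankOneOp w u x + (p.1 + p.2 • u)) :=
    hfx.comp hm
  rw [hQ, lintegral_map hfx hm, lintegral_prod _ hfm.aemeasurable]
  refine lintegral_congr fun z => ?_
  have hsh : gaussianReal ⟪w, x⟫_ℝ v = (gaussianReal 0 v).map (fun t => ⟪w, x⟫_ℝ + t) := by
    rw [gaussianReal_map_const_add, zero_add]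
  have hobs := measurable_observe u
  rw [hsh, lintegral_map (by fun_prop) (by fun_prop)]
  refine lintegral_congr fun t => ?_
  simp only [observe, rankOneOp_apply]
  congr 2
  rw [add_smul]
  abel

theorem sampleLaw_rankOneOp [IsProbabilityMeasure P] (hv : v ≠ 0) {u : L2}
    (hQ : Q = (ν.prod (gaussianReal 0 v)).map (fun p => p.1 + p.2 • u)) (w : L2) (n : ℕ) :
    sampleLaw P Q (rankOneOp w u) n =
      (Measure.pi fun _ : Fin n => (P.prod (ν.prod volume)).withDensity (shiftDensity w v)).map
        (fun ω i => observe u (ω i)) := by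
  have := isProbabilityMeasure_shiftDensity (P := P) (ν := ν) hv w
  have hmap : IsProbabilityMeasure
      (((P.prod (ν.prod volume)).withDensity (shiftDensity w v)).map (observe u)) :=
    Measure.isProbabilityMeasure_map (measurable_observe u).aemeasurable
  rw [sampleLaw, pairLaw_rankOneOp hv hQ w,
    Measure.pi_map_pi fun _ => (measurable_observe u).aemeasurable]

/-- Given `X = x` the affinity is `exp (-⟪w - w', x⟫² / (8 v))`. Bounding it below by `1 - ⟪w - w',
x⟫² / (8 v)` leaves only second moments of `X`, so no other feature of its law matters. -/
theorem one_sub_le_affinity_shiftDensity [IsProbabilityMeasure P] (hP : MemLp (id : L2 → L2) 2 P) (hv : v ≠ 0)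
    (w w' : L2) :
    ENNReal.ofReal (1 - ⟪covarianceOperator P (w - w'), w - w'⟫_ℝ / (8 * v)) ≤
      ∫⁻ ω, (shiftDensity w v ω * shiftDensity w' v ω) ^ (1 / 2 : ℝ)
        ∂(P.prod (ν.prod volume)) := by
  have hm : Measurable fun ω => (shiftDensity w v ω * shiftDensity w' v ω) ^ (1 / 2 : ℝ) :=
    ((measurable_shiftDensity w v).mul (measurable_shiftDensity w' v)).pow_const _
  have hint : Integrable (fun x => ⟪w - w', x⟫_ℝ * ⟪w - w', x⟫_ℝ) P :=
    (hP.const_inner (w - w')).integrable_mul (hP.const_inner (w - w'))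
  have hint' : Integrable (fun x => 1 - ⟪w - w', x⟫_ℝ * ⟪w - w', x⟫_ℝ / (8 * v)) P :=
    (integrable_const _).sub (hint.div_const _)
  rw [lintegral_prod _ hm.aemeasurable]
  have hinner : ∀ x, ∫⁻ y, (shiftDensity w v (x, y) * shiftDensity w' v (x, y)) ^ (1 / 2 : ℝ)
      ∂(ν.prod volume) =
      ENNReal.ofReal (Real.exp (-((⟪w, x⟫_ℝ - ⟪w', x⟫_ℝ) ^ 2 / (8 * v)))) := by
    intro x
    have hx : Measurable fun y =>
        (shiftDensity w v (x, y) * shiftDensity w' v (x, y)) ^ (1 / 2 : ℝ) :=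
      hm.comp measurable_prodMk_left
    rw [lintegral_prod _ hx.aemeasurable]
    simp only [shiftDensity, lintegral_sqrt_gaussianPDF_mul _ _ hv]
    simp
  simp_rw [hinner]
  have hmean : 1 - ⟪covarianceOperator P (w - w'), w - w'⟫_ℝ / (8 * v) =
      ∫ x, (1 - ⟪w - w', x⟫_ℝ * ⟪w - w', x⟫_ℝ / (8 * v)) ∂P := by
    rw [integral_sub (integrable_const _) (hint.div_const _), integral_div,
      covarianceOperator_inner hP]
    simp
  have hexp : Integrable
      (fun x => Real.exp (-((⟪w, x⟫_ℝ - ⟪w', x⟫_ℝ) ^ 2 / (8 * v)))) P := by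
    refine Integrable.of_bound (by fun_prop) 1 (ae_of_all _ fun x => ?_)
    rw [Real.norm_eq_abs, Real.abs_exp, Real.exp_le_one_iff]
    have : 0 ≤ (⟪w, x⟫_ℝ - ⟪w', x⟫_ℝ) ^ 2 / (8 * v) := by positivity
    linarith
  rw [hmean, ← ofReal_integral_eq_lintegral_ofReal hexp
    (ae_of_all _ fun x => (Real.exp_pos _).le)]
  refine ENNReal.ofReal_le_ofReal (integral_mono hint' hexp fun x => ?_)
  have := Real.add_one_le_exp (-((⟪w, x⟫_ℝ - ⟪w', x⟫_ℝ) ^ 2 / (8 * v)))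
  simp only [inner_sub_left, ← sq]
  linarith

end RankOneModel

/-! ### Rank one slopes: membership in the class and prediction error. -/

section SlopeClass

theorem isL2IntegralOperator_rankOneOp (w u : L2) : IsL2IntegralOperator (rankOneOp w u) := by
  have hw := Lp.memLp w
  have hu := Lp.memLp u
  have hk : MemLp (fun p : unitInterval × unitInterval => w p.1 * u p.2) 2 volume := by
    have hmeas : AEStronglyMeasurable (fun p : unitInterval × unitInterval => w p.1 * u p.2)
        volume := hw.aestronglyMeasurable.comp_fst.mul hu.aestronglyMeasurable.comp_snd
    rw [memLp_two_iff_integrable_sq hmeas]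
    have := ((memLp_two_iff_integrable_sq hw.aestronglyMeasurable).1 hw).mul_prod
      ((memLp_two_iff_integrable_sq hu.aestronglyMeasurable).1 hu)
    simp only [mul_pow]
    exact this
  refine ⟨hk.toLp, fun f => ?_⟩
  -- The kernel is `w s * u t`; the swap is needed because the sections are taken at fixed second
  -- variable `t`.
  have hswap : ∀ᵐ p : unitInterval × unitInterval,
      (hk.toLp : unitInterval × unitInterval → ℝ) p.swap = w p.2 * u p.1 :=
    (Measure.measurePreserving_swap (μ := (volume : Measure unitInterval))
      (ν := (volume : Measure unitInterval))).quasiMeasurePreserving.ae hk.coeFn_toLp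
  have hsec : ∀ᵐ t : unitInterval, ∀ᵐ s : unitInterval,
      (hk.toLp : unitInterval × unitInterval → ℝ) (s, t) = w s * u t :=
    Measure.ae_ae_of_ae_prod hswap
  rw [rankOneOp_apply]
  filter_upwards [hsec, Lp.coeFn_smul ⟪w, f⟫_ℝ u] with t ht hsm
  rw [hsm, Pi.smul_apply, smul_eq_mul, L2.inner_def, ← integral_mul_const]
  refine integral_congr_ae ?_
  filter_upwards [ht] with s hs
  rw [hs]
  simp
  ring

variable {P : Measure L2} {φ : HilbertBasis ℕ ℝ L2} {lam : ℕ → ℝ}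

/-- A positive operator maps an eigenvector of its square to a multiple of it. -/
theorem isPositive_apply_of_sq_apply {G : L2 →L[ℝ] L2} (hG : G.IsPositive) {x : L2} {l : ℝ}
    (hl : 0 < l) (hx : G (G x) = l • x) : G x = √l • x := by
  -- From `(G + √l)(G - √l) x = 0`, a nonzero `y` would be an eigenvector of `G` for `-√l`, which
  -- positivity excludes.
  set y := G x - √l • x with hy
  have hGy : G y = -(√l • y) := by
    rw [hy, map_sub, map_smul, hx, smul_sub, smul_smul, Real.mul_self_sqrt hl.le]
    abel
  have h0 : 0 ≤ ⟪G y, y⟫_ℝ := hG.inner_nonneg_left y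
  rw [hGy, inner_neg_left, inner_smul_left, real_inner_self_eq_norm_sq] at h0
  simp only [conj_trivial] at h0
  have hs : 0 < √l := Real.sqrt_pos.2 hl
  have hy0 : ‖y‖ ^ 2 ≤ 0 := by nlinarith [sq_nonneg ‖y‖]
  have : y = 0 := by
    rw [← norm_eq_zero]
    exact pow_eq_zero_iff two_ne_zero |>.1 (le_antisymm hy0 (sq_nonneg _))
  exact sub_eq_zero.1 this

/-- A bounded sequence of non-negative numbers is the sequence of eigenvalues of a positive
operator with eigenbasis `φ`. -/
theorem exists_isPositive_apply_eq_smul (φ : HilbertBasis ℕ ℝ L2) {l : ℕ → ℝ} {M : ℝ}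
    (hl0 : ∀ j, 0 ≤ l j) (hl : ∀ j, l j ≤ M) :
    ∃ G : L2 →L[ℝ] L2, G.IsPositive ∧ ∀ j, G (φ j) = l j • φ j := by
  have hM : 0 ≤ M := (hl0 0).trans (hl 0)
  have hbound : ∀ f : L2, ∀ j, ‖l j * φ.repr f j‖ ^ 2 ≤ M ^ 2 * ‖φ.repr f j‖ ^ 2 := fun f j => by
    rw [norm_mul, mul_pow, Real.norm_of_nonneg (hl0 j)]
    have := hl j
    have := hl0 j
    gcongr
  have hsum : ∀ f : L2, HasSum (fun j => ‖φ.repr f j‖ ^ 2) (‖f‖ ^ 2) := fun f => by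
    have := lp.hasSum_norm (p := 2) (by norm_num) (φ.repr f)
    simpa using this
  have hmem : ∀ f : L2, Memℓp (fun j => l j * φ.repr f j) 2 := fun f => by
    refine memℓp_gen ?_
    simpa using Summable.of_nonneg_of_le (fun j => sq_nonneg _) (hbound f)
      ((hsum f).summable.mul_left _)
  let L : L2 →ₗ[ℝ] L2 :=
    { toFun := fun f => φ.repr.symm ⟨fun j => l j * φ.repr f j, hmem f⟩
      map_add' := fun f g => by
        rw [← map_add]
        congr 1
        ext j
        simp [mul_add]
        rfl
      map_smul' := fun a f => by
        rw [RingHom.id_apply, ← map_smul]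
        congr 1
        ext j
        simp
        ring }
  have hrepr : ∀ f j, φ.repr (L f) j = l j * φ.repr f j := fun f j => by simp [L]
  have hle : ∀ f, ‖L f‖ ≤ M * ‖f‖ := fun f => by
    refine le_of_sq_le_sq ?_ (by positivity)
    rw [mul_pow]
    refine hasSum_le (fun j => ?_) (hsum (L f)) ((hsum f).mul_left _)
    rw [hrepr]
    exact hbound f j
  have hin : ∀ f g, HasSum (fun j => l j * (φ.repr f j * φ.repr g j)) ⟪L f, g⟫_ℝ := fun f g => by
    have := φ.hasSum_inner_mul_inner (L f) g
    have hterm : ∀ j, ⟪L f, φ j⟫_ℝ * ⟪φ j, g⟫_ℝ = l j * (φ.repr f j * φ.repr g j) := fun j => by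
      rw [real_inner_comm, ← φ.repr_apply_apply, ← φ.repr_apply_apply, hrepr, mul_assoc]
    simpa only [hterm] using this
  refine ⟨L.mkContinuous M hle, ⟨fun f g => ?_, fun f => ?_⟩, fun j => ?_⟩
  · have h := hin g f
    simp only [mul_comm (φ.repr g _)] at h
    exact (hin f g).unique (real_inner_comm f (L g) ▸ h)
  · exact (hin f f).nonneg fun j => mul_nonneg (hl0 j) (mul_self_nonneg _)
  · refine φ.repr.injective (lp.ext (funext fun i => ?_))
    change φ.repr (L (φ j)) i = φ.repr (l j • φ j) i
    rw [hrepr, map_smul, φ.repr_self, lp.coeFn_smul, Pi.smul_apply, smul_eq_mul]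
    by_cases h : i = j
    · rw [h]
    · simp [lp.single_apply, h]

/-- A diagonal root is built to rule out the default value `0` of `posSqrt`. The root actually
chosen may be any positive one, and each acts on `φ j` in the same way. -/
theorem posSqrt_covarianceOperator_apply (hP : IsCovariateLaw P φ lam) (j : ℕ) :
    posSqrt (covarianceOperator P) (φ j) = √(lam j) • φ j := by
  obtain ⟨G, hG, hGφ⟩ := exists_isPositive_apply_eq_smul φ (l := fun j => √(lam j))
    (fun j => Real.sqrt_nonneg _) (fun j => Real.sqrt_le_sqrt (hP.antitone j.zero_le))
  have hGG : G ∘L G = covarianceOperator P := by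
    refine ContinuousLinearMap.ext_on (s := Set.range φ) ?_ ?_
    · exact Submodule.dense_iff_topologicalClosure_eq_top.2 φ.dense_span
    · rintro _ ⟨i, rfl⟩
      rw [ContinuousLinearMap.comp_apply, hGφ, map_smul, hGφ, smul_smul,
        Real.mul_self_sqrt (hP.pos i).le, hP.eigen]
  have h : ∃ G : L2 →L[ℝ] L2, G.IsPositive ∧ G ∘L G = covarianceOperator P := ⟨G, hG, hGG⟩
  unfold posSqrt
  rw [dif_pos h]
  refine isPositive_apply_of_sq_apply h.choose_spec.1 (hP.pos j) ?_
  rw [← hP.eigen j]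
  exact congrArg (fun T : L2 →L[ℝ] L2 => T (φ j)) h.choose_spec.2
/-- The vector `∑ j, (c j / √λ_j) • φ_j`. -/
noncomputable def slopeVec (φ : HilbertBasis ℕ ℝ L2) (lam : ℕ → ℝ) {m : ℕ} (c : Fin m → ℝ) : L2 :=
  ∑ j : Fin m, (c j / √(lam j)) • φ j

theorem inner_slopeVec (φ : HilbertBasis ℕ ℝ L2) (lam : ℕ → ℝ) {m : ℕ} (c : Fin m → ℝ)
    (i : Fin m) : ⟪slopeVec φ lam c, φ i⟫_ℝ = c i / √(lam i) := by
  have := (φ.orthonormal.comp _ (Fin.val_injective (n := m))).inner_left_fintype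
    (fun j => c j / √(lam j)) i
  simpa [slopeVec] using this

theorem inner_slopeVec_of_le (φ : HilbertBasis ℕ ℝ L2) (lam : ℕ → ℝ) {m : ℕ} (c : Fin m → ℝ)
    {i : ℕ} (hi : m ≤ i) : ⟪slopeVec φ lam c, φ i⟫_ℝ = 0 := by
  rw [slopeVec, sum_inner]
  refine Finset.sum_eq_zero fun j _ => ?_
  rw [inner_smul_left, φ.orthonormal.2 (by have := j.2; omega), mul_zero]

theorem slopeVec_sub (φ : HilbertBasis ℕ ℝ L2) (lam : ℕ → ℝ) {m : ℕ} (c c' : Fin m → ℝ) :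
    slopeVec φ lam c - slopeVec φ lam c' = slopeVec φ lam (c - c') := by
  simp only [slopeVec, ← Finset.sum_sub_distrib, ← sub_smul, ← sub_div, Pi.sub_apply]

/-- The normalisation by `√λ_j` cancels the eigenvalues: the distance of two hypotheses seen through
the data is Euclidean in the coefficients. -/
theorem covarianceOperator_slopeVec (hP : IsCovariateLaw P φ lam) {m : ℕ} (c : Fin m → ℝ) :
    ⟪covarianceOperator P (slopeVec φ lam c), slopeVec φ lam c⟫_ℝ = ∑ j, c j ^ 2 := by
  conv_lhs => rw [slopeVec, map_sum, sum_inner]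
  refine Finset.sum_congr rfl fun j _ => ?_
  rw [map_smul, hP.eigen, inner_smul_left, inner_smul_left, real_inner_comm]
  change _ * (_ * ⟪slopeVec φ lam c, φ j⟫_ℝ) = _
  rw [inner_slopeVec]
  have hl : √(lam j) ≠ 0 := (Real.sqrt_pos.2 (hP.pos j)).ne'
  have hsq : √(lam j) ^ 2 = lam j := Real.sq_sqrt (hP.pos j).le
  simp only [conj_trivial]
  field_simp
  rw [hsq]

theorem sum_le_covarianceOperator (hP : IsCovariateLaw P φ lam) (m : ℕ) (v : L2) :
    ∑ j : Fin m, lam j * ⟪v, φ j⟫_ℝ ^ 2 ≤ ⟪covarianceOperator P v, v⟫_ℝ := by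
  have hs := φ.hasSum_inner_mul_inner (covarianceOperator P v) v
  have hterm : ∀ j, ⟪covarianceOperator P v, φ j⟫_ℝ * ⟪φ j, v⟫_ℝ = lam j * ⟪v, φ j⟫_ℝ ^ 2 := by
    intro j
    have hsym : ⟪covarianceOperator P v, φ j⟫_ℝ = ⟪v, covarianceOperator P (φ j)⟫_ℝ :=
      (isPositive_covarianceOperator (μ := P)).1 v (φ j)
    rw [hsym, hP.eigen, inner_smul_right, real_inner_comm v (φ j)]
    ring
  simp only [hterm] at hs
  rw [Fin.sum_univ_eq_sum_range (fun j => lam j * ⟪v, φ j⟫_ℝ ^ 2) m]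
  exact sum_le_hasSum _ (fun j _ => mul_nonneg (hP.pos j).le (sq_nonneg _)) hs

/-- For `T φ_j = c_j u` the double sum of the ellipsoid factors into `∑ η c²` and `∑ ψ ⟪u, φ_r⟫²`,
the latter being at most `K`. -/
theorem rankOneOp_mem_slopeClass (hP : IsCovariateLaw P φ lam) {η ψ : ℕ → ℝ} {K R : ℝ} {u : L2}
    (hη : ∀ j, 0 ≤ η (j + 1))
    (hu : (∑' r : ℕ, ENNReal.ofReal (ψ (r + 1) * ⟪u, φ r⟫_ℝ ^ 2)) ≤ ENNReal.ofReal K)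
    {m : ℕ} (c : Fin m → ℝ) (hc : (∑ j : Fin m, η (j + 1) * c j ^ 2) * K ≤ R ^ 2) :
    rankOneOp (slopeVec φ lam c) u ∈ slopeClass P η ψ R φ := by
  refine ⟨isL2IntegralOperator_rankOneOp _ _, ?_⟩
  set t : ℕ → ℝ := fun j => √(lam j) * ⟪slopeVec φ lam c, φ j⟫_ℝ with ht_def
  have ht : ∀ j,
      (rankOneOp (slopeVec φ lam c) u ∘L posSqrt (covarianceOperator P)) (φ j) = t j • u :=
    fun j => by
      rw [ContinuousLinearMap.comp_apply, posSqrt_covarianceOperator_apply hP, map_smul,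
        rankOneOp_apply, smul_smul]
  have htc : ∀ j : Fin m, t j = c j := fun j => by
    simp only [ht_def]
    rw [inner_slopeVec, mul_div_cancel₀ _ (Real.sqrt_pos.2 (hP.pos j)).ne']
  have ht0 : ∀ j, m ≤ j → t j = 0 := fun j hj => by
    simp only [ht_def, inner_slopeVec_of_le φ lam c hj, mul_zero]
  have hnn : ∀ j ∈ (Finset.univ : Finset (Fin m)), 0 ≤ η (j + 1) * c j ^ 2 :=
    fun j _ => mul_nonneg (hη j) (sq_nonneg _)
  refine ⟨⟨φ, summable_of_ne_finset_zero (s := Finset.range m) fun j hj => ?_⟩, ?_⟩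
  · rw [ht, ht0 j (by simpa using hj)]
    simp
  · have hterm : ∀ j r, ENNReal.ofReal (η (j + 1) * ψ (r + 1) *
        ⟪(rankOneOp (slopeVec φ lam c) u ∘L posSqrt (covarianceOperator P)) (φ j), φ r⟫_ℝ ^ 2) =
        ENNReal.ofReal (η (j + 1) * t j ^ 2) *
          ENNReal.ofReal (ψ (r + 1) * ⟪u, φ r⟫_ℝ ^ 2) := by
      intro j r
      rw [ht, inner_smul_left, ← ENNReal.ofReal_mul (mul_nonneg (hη j) (sq_nonneg _))]
      congr 1
      simp only [conj_trivial]
      ring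
    simp_rw [hterm, ENNReal.tsum_mul_left, ENNReal.tsum_mul_right]
    have hfin : ∑' j, ENNReal.ofReal (η (j + 1) * t j ^ 2) ≤
        ENNReal.ofReal (∑ j : Fin m, η (j + 1) * c j ^ 2) := by
      rw [tsum_eq_sum (s := Finset.range m) fun j hj => by
        rw [ht0 j (by simpa using hj)]; simp,
        ← Fin.sum_univ_eq_sum_range (fun j => ENNReal.ofReal (η (j + 1) * t j ^ 2)) m,
        ENNReal.ofReal_sum_of_nonneg hnn]
      exact (Finset.sum_congr rfl fun j _ => by rw [htc]).le
    calc _ ≤ ENNReal.ofReal (∑ j : Fin m, η (j + 1) * c j ^ 2) * ENNReal.ofReal K :=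
          mul_le_mul' hfin hu
      _ = ENNReal.ofReal ((∑ j : Fin m, η (j + 1) * c j ^ 2) * K) :=
          (ENNReal.ofReal_mul (Finset.sum_nonneg hnn)).symm
      _ ≤ _ := ENNReal.ofReal_le_ofReal hc

/-- The prediction error of `A` dominates the squared distance of the coefficients of `A` in the
direction `u` to those of the rank one slope. -/
theorem ofReal_sum_le_prediction_error (hP : IsCovariateLaw P φ lam) {u : L2} (hu : ‖u‖ = 1)
    {m : ℕ} (c : Fin m → ℝ) (A : L2 →L[ℝ] L2) :
    ∑ j : Fin m, ENNReal.ofReal ((√(lam j) * ⟪u, A (φ j)⟫_ℝ - c j) ^ 2) ≤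
      ∫⁻ x, ‖A x - rankOneOp (slopeVec φ lam c) u x‖ₑ ^ 2 ∂P := by
  set S := rankOneOp (slopeVec φ lam c) u with hS
  -- Projecting the error on the unit vector `u` can only shrink it and leaves the scalar functional
  -- `⟪v, x⟫`, of second moment `⟪Γ v, v⟫`.
  set v : L2 := ContinuousLinearMap.adjoint (A - S) u with hv
  have hvx : ∀ x, ⟪v, x⟫_ℝ = ⟪u, A x - S x⟫_ℝ := fun x => by
    rw [hv, ContinuousLinearMap.adjoint_inner_left]; rfl
  have hint : Integrable (fun x => ⟪v, x⟫_ℝ * ⟪v, x⟫_ℝ) P :=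
    (hP.memLp.const_inner v).integrable_mul (hP.memLp.const_inner v)
  have huu : ⟪u, u⟫_ℝ = 1 := by rw [real_inner_self_eq_norm_sq, hu]; norm_num
  have hcoef : ∀ j : Fin m, (√(lam j) * ⟪u, A (φ j)⟫_ℝ - c j) ^ 2 = lam j * ⟪v, φ j⟫_ℝ ^ 2 := by
    intro j
    have hl : √(lam j) ≠ 0 := (Real.sqrt_pos.2 (hP.pos j)).ne'
    have hSj : ⟪u, S (φ j)⟫_ℝ = c j / √(lam j) := by
      rw [hS, rankOneOp_apply, inner_slopeVec, inner_smul_right, huu, mul_one]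
    rw [hvx, inner_sub_right, hSj]
    nth_rw 2 [← Real.sq_sqrt (hP.pos j).le]
    rw [← mul_pow, mul_sub, mul_div_cancel₀ _ hl]
  calc _ = ENNReal.ofReal (∑ j : Fin m, lam j * ⟪v, φ j⟫_ℝ ^ 2) := by
        have hnn : ∀ j ∈ (Finset.univ : Finset (Fin m)), 0 ≤ lam j * ⟪v, φ j⟫_ℝ ^ 2 :=
          fun j _ => mul_nonneg (hP.pos j).le (sq_nonneg _)
        rw [ENNReal.ofReal_sum_of_nonneg hnn]
        simp_rw [hcoef]
    _ ≤ ENNReal.ofReal ⟪covarianceOperator P v, v⟫_ℝ :=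
        ENNReal.ofReal_le_ofReal (sum_le_covarianceOperator hP m v)
    _ = ∫⁻ x, ENNReal.ofReal (⟪v, x⟫_ℝ * ⟪v, x⟫_ℝ) ∂P := by
        rw [covarianceOperator_inner hP.memLp,
          ofReal_integral_eq_lintegral_ofReal hint (ae_of_all _ fun x => mul_self_nonneg _)]
    _ ≤ _ := by
        refine lintegral_mono fun x => ?_
        rw [← ofReal_norm, ← ENNReal.ofReal_pow (norm_nonneg _)]
        refine ENNReal.ofReal_le_ofReal ?_
        rw [← sq, hvx, ← sq_abs]
        have := abs_real_inner_le_norm u (A x - S x)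
        rw [hu, one_mul] at this
        gcongr

end SlopeClass

/-! ### Assouad's hypercube bound. -/

section Assouad

/-- Flipping one coordinate of a point of the hypercube. -/
def flipAt {m : ℕ} (j : Fin m) (θ : Fin m → Bool) : Fin m → Bool :=
  Function.update θ j (!θ j)

theorem flipAt_involutive {m : ℕ} (j : Fin m) : Function.Involutive (flipAt j) := by
  intro θ
  simp [flipAt]

/-- Assouad's averaging argument. -/
theorem assouad_average {m : ℕ} (e : (Fin m → Bool) → Fin m → ℝ≥0∞) {B M : ℝ≥0∞}
    (hB : ∀ θ j, B ≤ e θ j + e (flipAt j θ) j) (hM : ∀ θ, ∑ j, e θ j ≤ M) :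
    m * B ≤ 2 * M := by
  have hcard0 : (Fintype.card (Fin m → Bool) : ℝ≥0∞) ≠ 0 := by
    exact_mod_cast Fintype.card_ne_zero
  have hj : ∀ j, Fintype.card (Fin m → Bool) * B ≤ 2 * ∑ θ, e θ j := by
    intro j
    calc _ = ∑ _θ : Fin m → Bool, B := by simp
      _ ≤ ∑ θ, (e θ j + e (flipAt j θ) j) := Finset.sum_le_sum fun θ _ => hB θ j
      _ = 2 * ∑ θ, e θ j := by
        rw [Finset.sum_add_distrib, two_mul]
        congr 1
        exact Equiv.sum_comp (flipAt_involutive j).toPerm fun θ => e θ j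
  have h : Fintype.card (Fin m → Bool) * (m * B) ≤ Fintype.card (Fin m → Bool) * (2 * M) := by
    calc _ = ∑ _j : Fin m, Fintype.card (Fin m → Bool) * B := by simp; ring
      _ ≤ ∑ j, 2 * ∑ θ, e θ j := Finset.sum_le_sum fun j _ => hj j
      _ = 2 * ∑ θ, ∑ j, e θ j := by rw [← Finset.mul_sum, Finset.sum_comm]
      _ ≤ 2 * ∑ _θ : Fin m → Bool, M := by gcongr with θ; exact hM θ
      _ = _ := by simp; ring
  exact (ENNReal.mul_le_mul_iff_right hcard0 (ENNReal.natCast_ne_top _)).1 h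

variable {P Q : Measure L2} {φ : HilbertBasis ℕ ℝ L2} {lam : ℕ → ℝ}

/-- Two rank one slopes whose coefficients differ by `a` in a single place cannot be told apart
from `n` observations when `n a² ≤ 4 s`. -/
theorem two_point_sampleLaw (hP : IsCovariateLaw P φ lam) (hQ : IsGaussianNoiseLaw Q) {u : L2}
    (hu : ‖u‖ = 1) {s : ℝ} (hs : 0 < s)
    (hsu : ∀ f : L2, s * ⟪u, f⟫_ℝ ^ 2 ≤ ⟪covarianceOperator Q f, f⟫_ℝ) {n m : ℕ} (hn : 1 ≤ n)
    {A : ℝ} (hA : n * A ≤ 4 * s) {c c' : Fin m → ℝ}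
    (hc : ∑ j, (c j - c' j) ^ 2 = A) (j : Fin m) (hj : (c j - c' j) ^ 2 = A)
    {b : (Fin n → L2 × L2) → ℝ} (hb : Measurable b) :
    ENNReal.ofReal (A / 16) ≤
      ∫⁻ d, ENNReal.ofReal ((b d - c j) ^ 2)
        ∂(sampleLaw P Q (rankOneOp (slopeVec φ lam c) u) n) +
      ∫⁻ d, ENNReal.ofReal ((b d - c' j) ^ 2)
        ∂(sampleLaw P Q (rankOneOp (slopeVec φ lam c') u) n) := by
  have := hP.isProbabilityMeasure
  have := hQ.isGaussian
  obtain ⟨ν, v, hν, hsv, hdec⟩ := exists_gaussian_decomposition Q hQ.centered hu hsu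
  have hv0 : 0 < (v : ℝ) := hs.trans_le hsv
  have hv : v ≠ 0 := by
    rintro rfl
    simp at hv0
  have hA0 : 0 ≤ A := hj ▸ sq_nonneg _
  set w := slopeVec φ lam c with hw
  set w' := slopeVec φ lam c' with hw'
  have := isProbabilityMeasure_shiftDensity (P := P) (ν := ν) hv w
  have := isProbabilityMeasure_shiftDensity (P := P) (ν := ν) hv w'
  have hobs : Measurable fun (ω : Fin n → L2 × L2 × ℝ) i => observe u (ω i) :=
    measurable_pi_lambda _ fun i => (measurable_observe u).comp (measurable_pi_apply i)
  have hF : ∀ x : ℝ, Measurable fun d => ENNReal.ofReal ((b d - x) ^ 2) := fun x => by fun_prop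
  rw [sampleLaw_rankOneOp hv hdec w n, sampleLaw_rankOneOp hv hdec w' n,
    lintegral_map (hF _) hobs, lintegral_map (hF _) hobs]
  -- `A / 2` is the least value of `(b - c j)² + (b - c' j)²`, reached when `b` is the midpoint.
  have htwo := two_point_pi (P.prod (ν.prod volume)) (measurable_shiftDensity w v)
    (measurable_shiftDensity w' v) n (a := ENNReal.ofReal (A / 2))
    ((hF (c j)).comp hobs) ((hF (c' j)).comp hobs) (fun ω => by
      simp only [Function.comp_apply]
      rw [← ENNReal.ofReal_add (sq_nonneg _) (sq_nonneg _)]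
      refine ENNReal.ofReal_le_ofReal ?_
      rw [← hj]
      nlinarith [sq_nonneg ((b fun i => observe u (ω i)) - c j +
        ((b fun i => observe u (ω i)) - c' j))])
  have hquad : ⟪covarianceOperator P (w - w'), w - w'⟫_ℝ = A := by
    rw [hw, hw', slopeVec_sub, covarianceOperator_slopeVec hP]
    exact hc
  have haff := one_sub_le_affinity_shiftDensity (ν := ν) hP.memLp hv w w'
  rw [hquad] at haff
  have hn' : (1 : ℝ) ≤ n := by exact_mod_cast hn
  -- From `n A ≤ 4 s ≤ 4 v`. Bernoulli's inequality then gives an `n`-fold affinity of at least `1 /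
  -- 2`; its square `1 / 4`, times `A / 2` and divided by the `2` of `two_point_pi`, is `A / 16`.
  have hx : A / (8 * v) * n ≤ 1 / 2 := by
    rw [div_mul_eq_mul_div, div_le_iff₀ (by positivity)]
    linarith
  have hx0 : 0 ≤ A / (8 * v) := by positivity
  have hx1 : A / (8 * v) ≤ 1 / 2 := (le_mul_of_one_le_right hx0 hn').trans hx
  have hbern : 1 / 2 ≤ (1 - A / (8 * v)) ^ n := by
    have := one_add_mul_le_pow (a := -(A / (8 * v))) (by linarith) n
    rw [← sub_eq_add_neg] at this
    linarith
  have hpow : ENNReal.ofReal (1 / 4) ≤ ((∫⁻ ω, (shiftDensity w v ω * shiftDensity w' v ω) ^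
      (1 / 2 : ℝ) ∂(P.prod (ν.prod volume))) ^ n) ^ 2 := by
    calc ENNReal.ofReal (1 / 4) ≤ ENNReal.ofReal (((1 - A / (8 * v)) ^ n) ^ 2) :=
          ENNReal.ofReal_le_ofReal (by nlinarith)
      _ = (ENNReal.ofReal (1 - A / (8 * v)) ^ n) ^ 2 := by
          rw [ENNReal.ofReal_pow (by positivity), ENNReal.ofReal_pow (by linarith)]
      _ ≤ _ := by gcongr
  have hfinal : 2 * ENNReal.ofReal (A / 16) = ENNReal.ofReal (A / 2) * ENNReal.ofReal (1 / 4) := by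
    rw [← ENNReal.ofReal_mul (by positivity), ← ENNReal.ofReal_ofNat,
      ← ENNReal.ofReal_mul (by norm_num)]
    congr 1
    ring
  refine (ENNReal.mul_le_mul_iff_right two_ne_zero ENNReal.ofNat_ne_top).1 ?_
  rw [hfinal]
  exact (mul_le_mul_right hpow _).trans htwo

/-- Lower bound for the minimax risk over a hypercube with `m` directions and squared
side length `A`. -/
theorem ofReal_le_minimaxRisk (hP : IsCovariateLaw P φ lam) (hQ : IsGaussianNoiseLaw Q)
    {η ψ : ℕ → ℝ} {K R s : ℝ} (hs : 0 < s) (hQu : NoiseCharges Q φ ψ K s)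
    (hη : ∀ j, 0 ≤ η (j + 1)) {n m : ℕ} (hn : 1 ≤ n) {A : ℝ} (hA0 : 0 ≤ A) (hA : n * A ≤ 4 * s)
    (hAR : A * (∑ j : Fin m, η (j + 1)) * max K 1 ≤ R ^ 2) :
    ENNReal.ofReal (m * A / 32) ≤ minimaxRisk P Q η ψ R φ n := by
  obtain ⟨u, hu, huK, hsu⟩ := hQu
  refine le_iInf fun Shat => ?_
  -- The hypotheses are the vertices of a cube of side `√A`, so neighbours differ by `A` in squared
  -- distance.
  set c : (Fin m → Bool) → Fin m → ℝ := fun θ j => if θ j then √A else 0 with hc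
  set b : Fin m → (Fin n → L2 × L2) → ℝ := fun j d => √(lam j) * ⟪u, Shat.toFun d (φ j)⟫_ℝ with hb
  have hbm : ∀ j, Measurable (b j) := fun j =>
    ((measurable_const.inner (Shat.measurable_apply (φ j))).const_mul _)
  have hsq : √A ^ 2 = A := Real.sq_sqrt hA0
  have hcsq : ∀ θ j, c θ j ^ 2 ≤ A := by
    intro θ j
    simp only [hc]
    split_ifs
    · exact hsq.le
    · simpa using hA0
  have hflip : ∀ θ j, (c θ j - c (flipAt j θ) j) ^ 2 = A := by
    intro θ j
    by_cases h : θ j = true <;> simp [hc, flipAt, h, hsq]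
  have hflip' : ∀ θ j, ∑ i, (c θ i - c (flipAt j θ) i) ^ 2 = A := by
    intro θ j
    rw [Finset.sum_eq_single j, hflip]
    · intro i _ hij
      simp [hc, flipAt, Function.update_of_ne hij]
    · simp
  have hmem : ∀ θ, rankOneOp (slopeVec φ lam (c θ)) u ∈ slopeClass P η ψ R φ := by
    intro θ
    refine rankOneOp_mem_slopeClass hP hη
      (huK.trans (ENNReal.ofReal_le_ofReal (le_max_left K 1))) (c θ) (le_trans ?_ hAR)
    rw [Finset.mul_sum]
    refine mul_le_mul_of_nonneg_right (Finset.sum_le_sum fun j _ => ?_)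
      (zero_le_one.trans (le_max_right K 1))
    rw [mul_comm]
    exact mul_le_mul_of_nonneg_right (hcsq θ j) (hη j)
  have hass := assouad_average (B := ENNReal.ofReal (A / 16))
    (fun θ j => ∫⁻ d, ENNReal.ofReal ((b j d - c θ j) ^ 2)
      ∂(sampleLaw P Q (rankOneOp (slopeVec φ lam (c θ)) u) n))
    (M := ⨆ S ∈ slopeClass P η ψ R φ, mspe P Q Shat S)
    (fun θ j => two_point_sampleLaw hP hQ hu hs hsu hn hA (hflip' θ j) j (hflip θ j) (hbm j))
    (fun θ => by
      refine le_trans ?_ (le_iSup₂ (f := fun S _ => mspe P Q Shat S) _ (hmem θ))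
      rw [← lintegral_finsetSum _ fun j _ => by have := hbm j; fun_prop]
      exact lintegral_mono fun d => ofReal_sum_le_prediction_error hP hu (c θ) (Shat.toFun d))
  have hfinal : 2 * ENNReal.ofReal (m * A / 32) = m * ENNReal.ofReal (A / 16) := by
    rw [← ENNReal.ofReal_natCast, ← ENNReal.ofReal_mul (by positivity), ← ENNReal.ofReal_ofNat,
      ← ENNReal.ofReal_mul (by norm_num)]
    congr 1
    ring
  refine (ENNReal.mul_le_mul_iff_right two_ne_zero ENNReal.ofNat_ne_top).1 ?_
  rw [hfinal]
  exact hass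

end Assouad

/-! ### Choice of the dimension and the two rates. -/

section Rates

theorem Asymp.pos_and_le {a b : ℕ → ℝ} (h : Asymp a b) (hb : ∀ j, 1 ≤ j → 0 < b j) :
    ∃ c : ℝ, 1 ≤ c ∧ ∀ j, 1 ≤ j → 0 < a j ∧ a j ≤ c * b j := by
  obtain ⟨c, hc, h⟩ := h
  have hc0 : 0 < c := by linarith
  refine ⟨c, hc, fun j hj => ⟨?_, ?_⟩⟩
  · exact pos_of_mul_pos_right ((hb j hj).trans_le (h j hj).2) hc0.le
  · exact (inv_mul_le_iff₀ hc0).1 (h j hj).1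

/-- Rate-free form of the lower bound: `m` coefficients of squared size `κ / n` can be hidden. -/
theorem exists_const_le_minimaxRisk {R K s : ℝ} (hR : 0 < R) (hs : 0 < s) {η ψ g : ℕ → ℝ}
    (hη : Asymp η g) (hg : ∀ j, 1 ≤ j → 0 < g j) (D : ℝ) (hD : 0 < D) :
    ∃ κ : ℝ, 0 < κ ∧ ∀ (P Q : Measure L2) (φ : HilbertBasis ℕ ℝ L2) (lam : ℕ → ℝ),
      IsCovariateLaw P φ lam → IsGaussianNoiseLaw Q → NoiseCharges Q φ ψ K s →
      ∀ n m : ℕ, 1 ≤ n → ∑ j : Fin m, g (j + 1) ≤ D * n →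
        ENNReal.ofReal (κ * (m / n)) ≤ minimaxRisk P Q η ψ R φ n := by
  obtain ⟨c, hc, hηc⟩ := hη.pos_and_le hg
  have hK : (1 : ℝ) ≤ max K 1 := le_max_right _ _
  have hK0 : 0 < max K 1 := zero_lt_one.trans_le hK
  have hc0 : 0 < c := by linarith
  -- With `A = κ / n`, the first bound gives indistinguishability and the second keeps the cube in
  -- the ellipsoid, where `∑ η ≤ c D n`. Replacing `K` by `max K 1` makes the divisor positive.
  set κ := min (4 * s) (R ^ 2 / (c * D * max K 1)) with hκ
  have hκ0 : 0 < κ := lt_min (by positivity) (by positivity)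
  refine ⟨κ / 32, by positivity, fun P Q φ lam hP hQ hu n m hn hsum => ?_⟩
  have hn0 : (0 : ℝ) < n := by exact_mod_cast hn
  have := ofReal_le_minimaxRisk hP hQ (R := R) (m := m) hs hu
    (fun j => (hηc (j + 1) (by omega)).1.le) hn (A := κ / n) (by positivity)
    (by rw [mul_div_cancel₀ _ hn0.ne']; exact min_le_left _ _)
    (by
      have h1 : ∑ j : Fin m, η (j + 1) ≤ c * (D * n) := by
        calc _ ≤ ∑ j : Fin m, c * g (j + 1) :=
              Finset.sum_le_sum fun j _ => (hηc (j + 1) (by omega)).2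
          _ = c * ∑ j : Fin m, g (j + 1) := by rw [Finset.mul_sum]
          _ ≤ _ := by gcongr
      calc κ / n * (∑ j : Fin m, η (j + 1)) * max K 1
          ≤ κ / n * (c * (D * n)) * max K 1 := by gcongr
        _ = κ * (c * D * max K 1) := by field_simp
        _ ≤ R ^ 2 / (c * D * max K 1) * (c * D * max K 1) := by
            gcongr
            exact min_le_right _ _
        _ = R ^ 2 := div_mul_cancel₀ _ (by positivity))
  refine le_trans (ENNReal.ofReal_le_ofReal (le_of_eq ?_)) this
  ring

theorem sum_fin_succ_le {g : ℕ → ℝ} {m : ℕ} {G : ℝ} (hg : ∀ j, 1 ≤ j → j ≤ m → g j ≤ G) :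
    ∑ j : Fin m, g (j + 1) ≤ m * G := by
  calc _ ≤ ∑ _j : Fin m, G := Finset.sum_le_sum fun j _ => hg _ (by omega) (by omega)
    _ = _ := by simp

theorem half_le_max_floor {y : ℝ} : y / 2 ≤ (max 1 ⌊y⌋₊ : ℕ) := by
  have h := Nat.lt_floor_add_one y
  have h1 : (1 : ℝ) ≤ (max 1 ⌊y⌋₊ : ℕ) := by exact_mod_cast le_max_left _ _
  have h2 : (⌊y⌋₊ : ℝ) ≤ (max 1 ⌊y⌋₊ : ℕ) := by exact_mod_cast le_max_right _ _
  linarith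

theorem exists_dimension_poly {α : ℝ} (hα : 0 < α) {n : ℕ} (hn : 1 ≤ n) :
    ∃ m : ℕ, ∑ j : Fin m, (((j : ℕ) + 1 : ℕ) : ℝ) ^ α ≤ 1 * n ∧
      (n : ℝ) ^ (-(α / (α + 1))) / 2 ≤ m / n := by
  have hn1 : (1 : ℝ) ≤ n := by exact_mod_cast hn
  have hn0 : (0 : ℝ) < n := by linarith
  -- The sum is at most `m · m ^ α`, and `y` solves `y ^ (α + 1) = n`.
  set y : ℝ := (n : ℝ) ^ (1 / (α + 1)) with hy
  have hy1 : 1 ≤ y := Real.one_le_rpow hn1 (by positivity)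
  have hmax : (max 1 ⌊y⌋₊ : ℕ) = ⌊y⌋₊ := max_eq_right (Nat.le_floor (by simpa using hy1))
  refine ⟨⌊y⌋₊, ?_, ?_⟩
  · have hm : (⌊y⌋₊ : ℝ) ≤ y := Nat.floor_le (by linarith)
    calc _ ≤ (⌊y⌋₊ : ℝ) * y ^ α := sum_fin_succ_le (g := fun j => (j : ℝ) ^ α) fun j _ hj =>
          Real.rpow_le_rpow (by positivity) (le_trans (by exact_mod_cast hj) hm) hα.le
      _ ≤ y * y ^ α := by gcongr
      _ = y ^ (α + 1) := by rw [Real.rpow_add (by linarith), Real.rpow_one]; ring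
      _ = 1 * n := by
        rw [hy, ← Real.rpow_mul hn0.le, one_div, inv_mul_cancel₀ (by positivity), Real.rpow_one,
          one_mul]
  · have h := half_le_max_floor (y := y)
    rw [hmax] at h
    have hexp : (n : ℝ) ^ (-(α / (α + 1))) = y / n := by
      rw [hy, eq_div_iff hn0.ne']
      nth_rw 2 [← Real.rpow_one (n : ℝ)]
      rw [← Real.rpow_add hn0]
      congr 1
      field_simp
      ring
    rw [hexp, div_right_comm]
    gcongr

theorem exists_dimension_exp {α : ℝ} (hα : 0 < α) :
    ∃ D : ℝ, 0 < D ∧ ∀ n : ℕ, 1 ≤ n →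
      ∃ m : ℕ, ∑ j : Fin m, Real.exp ((((j : ℕ) + 1 : ℕ) : ℝ) ^ α) ≤ D * n ∧
        (1 / 2 : ℝ) ^ (1 / α) / 2 * (Real.log n ^ (1 / α) / n) ≤ m / n := by
  refine ⟨max 1 ((1 / α) ^ (1 / α)) * Real.exp 1, by positivity, fun n hn => ?_⟩
  have hn1 : (1 : ℝ) ≤ n := by exact_mod_cast hn
  have hn0 : (0 : ℝ) < n := by linarith
  have hlog : 0 ≤ Real.log n := Real.log_nonneg hn1
  -- The factor `1 / 2` makes each term of the sum of order `√n`, leaving another `√n` to absorb the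
  -- number `m` of terms.
  set y : ℝ := (1 / 2 * Real.log n) ^ (1 / α) with hy
  have hy0 : 0 ≤ y := by positivity
  have hyα : y ^ α = 1 / 2 * Real.log n := by
    rw [hy, ← Real.rpow_mul (by positivity), one_div_mul_cancel hα.ne', Real.rpow_one]
  have hexp : Real.exp (1 / 2 * Real.log n) = (n : ℝ) ^ (1 / 2 : ℝ) := by
    rw [Real.rpow_def_of_pos hn0, mul_comm]
  have hsqrt1 : 1 ≤ (n : ℝ) ^ (1 / 2 : ℝ) := Real.one_le_rpow hn1 (by norm_num)
  have hsq : (n : ℝ) ^ (1 / 2 : ℝ) * (n : ℝ) ^ (1 / 2 : ℝ) = n := by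
    rw [← Real.rpow_add hn0]; norm_num
  have hyle : y ≤ (1 / α) ^ (1 / α) * (n : ℝ) ^ (1 / 2 : ℝ) := by
    have hl := Real.log_le_rpow_div hn0.le (half_pos hα)
    calc y ≤ (1 / α * (n : ℝ) ^ (α / 2)) ^ (1 / α) := by
          refine Real.rpow_le_rpow (by positivity) ?_ (by positivity)
          calc 1 / 2 * Real.log n ≤ 1 / 2 * ((n : ℝ) ^ (α / 2) / (α / 2)) := by gcongr
            _ = _ := by field_simp
      _ = _ := by
          rw [Real.mul_rpow (by positivity) (by positivity), ← Real.rpow_mul hn0.le]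
          congr 2
          field_simp
  set m : ℕ := max 1 ⌊y⌋₊ with hm
  have hmle : (m : ℝ) ≤ max 1 y := by
    rw [hm, Nat.cast_max, Nat.cast_one]
    exact max_le_max le_rfl (Nat.floor_le hy0)
  have hmD : (m : ℝ) ≤ max 1 ((1 / α) ^ (1 / α)) * (n : ℝ) ^ (1 / 2 : ℝ) := by
    refine hmle.trans (max_le ?_ (hyle.trans ?_))
    · exact one_le_mul_of_one_le_of_one_le (le_max_left _ _) hsqrt1
    · gcongr
      exact le_max_right _ _
  -- The additive `1` covers small `n`, where `y < 1` and `m = 1`; it is the source of the factor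
  -- `exp 1` in `D`.
  have hmα : (m : ℝ) ^ α ≤ 1 + 1 / 2 * Real.log n := by
    rcases le_total 1 y with h | h
    · rw [max_eq_right h] at hmle
      calc _ ≤ y ^ α := Real.rpow_le_rpow (by positivity) hmle hα.le
        _ ≤ _ := by rw [hyα]; linarith
    · rw [max_eq_left h] at hmle
      calc _ ≤ (1 : ℝ) ^ α := Real.rpow_le_rpow (by positivity) hmle hα.le
        _ ≤ _ := by rw [Real.one_rpow]; linarith
  refine ⟨m, ?_, ?_⟩
  · calc _ ≤ (m : ℝ) * (Real.exp 1 * (n : ℝ) ^ (1 / 2 : ℝ)) :=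
          sum_fin_succ_le (g := fun j => Real.exp ((j : ℝ) ^ α)) fun j _ hj => by
            rw [← hexp, ← Real.exp_add]
            refine Real.exp_le_exp.2 (le_trans ?_ hmα)
            exact Real.rpow_le_rpow (by positivity) (by exact_mod_cast hj) hα.le
      _ ≤ max 1 ((1 / α) ^ (1 / α)) * (n : ℝ) ^ (1 / 2 : ℝ) *
            (Real.exp 1 * (n : ℝ) ^ (1 / 2 : ℝ)) := by gcongr
      _ = max 1 ((1 / α) ^ (1 / α)) * Real.exp 1 *
            ((n : ℝ) ^ (1 / 2 : ℝ) * (n : ℝ) ^ (1 / 2 : ℝ)) := by ring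
      _ = _ := by rw [hsq]
  · have h := half_le_max_floor (y := y)
    rw [← hm] at h
    calc _ = y / 2 / n := by
          rw [hy, Real.mul_rpow (by norm_num) hlog]
          ring
      _ ≤ _ := by gcongr

end Rates

end FunLinReg

theorem mainTheorem5
    (α β R K s : ℝ) (hα : 0 < α) (hβ : 0 < β) (hR : 0 < R) (hs : 0 < s)
    (η ψ : ℕ → ℝ) (hψ : FunLinReg.PolyCase β ψ ∨ FunLinReg.ExpCase β ψ) :
    (FunLinReg.PolyCase α η →
      ∃ C : ℝ, 0 < C ∧
        ∀ (P Q : Measure FunLinReg.L2) (φ : HilbertBasis ℕ ℝ FunLinReg.L2) (lam : ℕ → ℝ),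
          FunLinReg.IsCovariateLaw P φ lam →
          FunLinReg.IsGaussianNoiseLaw Q →
          FunLinReg.NoiseCharges Q φ ψ K s →
          ∀ n : ℕ, 1 ≤ n →
            ENNReal.ofReal (C * (n : ℝ) ^ (-(α / (α + 1)))) ≤
              FunLinReg.minimaxRisk P Q η ψ R φ n) ∧
    (FunLinReg.ExpCase α η →
      ∃ C : ℝ, 0 < C ∧
        ∀ (P Q : Measure FunLinReg.L2) (φ : HilbertBasis ℕ ℝ FunLinReg.L2) (lam : ℕ → ℝ),
          FunLinReg.IsCovariateLaw P φ lam →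
          FunLinReg.IsGaussianNoiseLaw Q →
          FunLinReg.NoiseCharges Q φ ψ K s →
          ∀ n : ℕ, 1 ≤ n →
            ENNReal.ofReal (C * (Real.log n ^ (1 / α) / n)) ≤
              FunLinReg.minimaxRisk P Q η ψ R φ n) := by
  refine ⟨fun hη => ?_, fun hη => ?_⟩
  · obtain ⟨κ, hκ, h⟩ := FunLinReg.exists_const_le_minimaxRisk (K := K) (ψ := ψ) hR hs hη
      (fun j hj => Real.rpow_pos_of_pos (by exact_mod_cast hj) α) 1 one_pos
    refine ⟨κ / 2, by positivity, fun P Q φ lam hP hQ hu n hn => ?_⟩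
    obtain ⟨m, hsum, hm⟩ := FunLinReg.exists_dimension_poly hα hn
    refine le_trans (ENNReal.ofReal_le_ofReal ?_) (h P Q φ lam hP hQ hu n m hn hsum)
    calc _ = κ * ((n : ℝ) ^ (-(α / (α + 1))) / 2) := by ring
      _ ≤ _ := by gcongr
  · obtain ⟨D, hD, hdim⟩ := FunLinReg.exists_dimension_exp hα
    obtain ⟨κ, hκ, h⟩ := FunLinReg.exists_const_le_minimaxRisk (K := K) (ψ := ψ) hR hs hη
      (fun j _ => Real.exp_pos _) D hD
    refine ⟨κ * ((1 / 2 : ℝ) ^ (1 / α) / 2), by positivity, fun P Q φ lam hP hQ hu n hn => ?_⟩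
    obtain ⟨m, hsum, hm⟩ := hdim n hn
    refine le_trans (ENNReal.ofReal_le_ofReal ?_) (h P Q φ lam hP hQ hu n m hn hsum)
    rw [mul_assoc]
    gcongr
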